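/- There are universal constants $c, C > 0$ such that the following holds for every integer $k \ge 1$ and every $k$-vertex-connected finite simple graph $G=(V,E)$ with $n$ nodes (that is, $n > k$, and $G$ stays connected after the removal of any fewer than $k$ nodes). A connected dominating set (CDS) of $G$ is a set $S \subseteq V$ such that every node of $V \setminus S$ has a neighbor in $S$ and the induced subgraph $G[S]$ is connected (in particular $S \neq \emptyset$). A CDS packing of $G$ assigns a weight $x_\tau \ge 0$ to each CDS $\tau$ of $G$ such that $\sum_{\tau \ni v} x_\tau \le 1$ for every node $v \in V$; its size is $\sum_\tau x_\tau$. The graph $G$ has a collection $\mathcal F$ of $k$ (distinct) CDSs such that each $\tau \in \mathcal F$ consists of at most $C\,\frac{n \log n}{k}$ nodes and each node of $G$ lies in at most $C \log n$ members of $\mathcal F$, and $G$ has a CDS packing, with non-zero weights only on members of $\mathcal F$, of size at least $c\left(\frac{k}{\log n} + 1\right)$. -/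

import Mathlib

universe u

/-- `G` is `k`-vertex-connected: it has more than `k` nodes, and it stays connected after the
removal of any fewer than `k` nodes. -/
def IsVertexConnected {V : Type u} [Fintype V] (G : SimpleGraph V) (k : ℕ) : Prop :=
  k < Fintype.card V ∧
    ∀ S : Finset V, S.card < k → (G.induce {v : V | v ∉ S}).Connected

/-- `S` is a dominating set: every node outside `S` has a neighbor in `S`. -/
def IsDominatingSet {V : Type u} (G : SimpleGraph V) (S : Finset V) : Prop :=
  ∀ u : V, u ∉ S → ∃ v ∈ S, G.Adj u v

/-- `S` is a connected dominating set (CDS). -/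
def IsCDS {V : Type u} (G : SimpleGraph V) (S : Finset V) : Prop :=
  IsDominatingSet G S ∧ (G.induce {v : V | v ∈ S}).Connected

open Classical in
/-- The set of all CDSs of `G`. -/
noncomputable def cdsFinset {V : Type u} [Fintype V] (G : SimpleGraph V) : Finset (Finset V) :=
  Finset.univ.filter fun S => IsCDS G S

/-- A CDS packing: non-negative weights on the CDSs of `G` such that the CDSs containing any
given node have total weight at most `1` (the values of `x` on sets that are not CDSs are
irrelevant). -/
def IsCDSPacking {V : Type u} [Fintype V] [DecidableEq V] (G : SimpleGraph V)
    (x : Finset V → ℝ) : Prop :=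
  (∀ τ ∈ cdsFinset G, 0 ≤ x τ) ∧
    ∀ v : V, ∑ τ ∈ (cdsFinset G).filter (fun τ => v ∈ τ), x τ ≤ 1

/-- The size of a CDS packing: the total weight of all CDSs. -/
noncomputable def cdsPackingSize {V : Type u} [Fintype V] (G : SimpleGraph V)
    (x : Finset V → ℝ) : ℝ :=
  ∑ τ ∈ cdsFinset G, x τ

/-! Grow t = k/3 vertex classes simultaneously, starting from empty ones, in 2L layers with L of
order log n; in each layer every vertex joins at most two classes, so overlaps stay at most 4L.
During the first L layers the potential is the number of pairs (vertex, class) without a neighbor of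
the vertex in the class; during the last L it is the total number of excess components. A layer
multiplies the potential by at most 15/16, and it starts at no more than n², so it reaches 0 and all
classes become CDSs. The decrease comes from `exists_assignment`, a second-moment argument, fed by
`le_card_neighbors` in the first phase and by `exists_connectors` in the second: each component of a
disconnected dominating class has t ways to be joined to another one by one or two new vertices. For
k well above log n, eight copies of each light class, made distinct by one extra vertex each
(`exists_injective_insert`), supply the k sets, and uniform weights give the packing. For k = O(log
n) the size and overlap bounds are trivial, and a single CDS is a large enough packing. -/

/-! ### Random assignments of vertices to classes -/

open Finset in
theorem card_filter_forall_eq_mul {V Q : Type*} [Fintype V] [DecidableEq V] [Fintype Q]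
    [DecidableEq Q] (A : Finset V) (f : V → Q) :
    #{φ : V → Q | ∀ a ∈ A, φ a = f a} * Fintype.card Q ^ #A
      = Fintype.card Q ^ Fintype.card V := by
  have h : ({φ : V → Q | ∀ a ∈ A, φ a = f a} : Finset (V → Q))
      = Fintype.piFinset (fun v => if v ∈ A then {f v} else univ) := by
    ext φ
    simp only [mem_filter, mem_univ, true_and, Fintype.mem_piFinset]
    refine forall_congr' fun a => ?_
    by_cases ha : a ∈ A <;> simp [ha]
  have h2 : ∀ v : V, #(if v ∈ A then {f v} else (univ : Finset Q))
      = if v ∈ A then 1 else Fintype.card Q := by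
    intro v; split_ifs <;> simp
  rw [h, Fintype.card_piFinset, prod_congr rfl (fun v _ => h2 v), prod_ite]
  simp only [prod_const_one, one_mul, prod_const]
  rw [← pow_add]
  congr 1
  rw [← card_univ (α := V), ← card_filter_add_card_filter_not (s := univ) (fun v => v ∈ A)]
  rw [filter_mem_eq_inter, univ_inter, add_comm]

open Finset in
theorem sum_indicator_eq {V Q : Type*} [Fintype V] [DecidableEq V] [Fintype Q] [Nonempty Q]
    [DecidableEq Q] (a : V) (x : Q) :
    ∑ φ : V → Q, (if φ a = x then (1 : ℝ) else 0)
      = (Fintype.card Q : ℝ) ^ Fintype.card V / Fintype.card Q := by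
  have h := card_filter_forall_eq_mul (Q := Q) {a} (fun _ => x)
  have hq : (Fintype.card Q : ℝ) ≠ 0 := by exact_mod_cast Fintype.card_ne_zero
  rw [eq_div_iff hq, sum_boole]
  simp only [mem_singleton, forall_eq, card_singleton, pow_one] at h
  exact_mod_cast h

open Finset in
theorem sum_indicator_mul_eq {V Q : Type*} [Fintype V] [DecidableEq V] [Fintype Q] [Nonempty Q]
    [DecidableEq Q] {a b : V} (hab : a ≠ b) (x y : Q) :
    ∑ φ : V → Q, (if φ a = x then (1 : ℝ) else 0) * (if φ b = y then (1 : ℝ) else 0)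
      = (Fintype.card Q : ℝ) ^ Fintype.card V / (Fintype.card Q : ℝ) ^ 2 := by
  have h := card_filter_forall_eq_mul (Q := Q) {a, b} (fun v => if v = a then x else y)
  have hq : (Fintype.card Q : ℝ) ≠ 0 := by exact_mod_cast Fintype.card_ne_zero
  rw [eq_div_iff (pow_ne_zero _ hq)]
  have e : ∀ φ : V → Q, (if φ a = x then (1 : ℝ) else 0) * (if φ b = y then (1 : ℝ) else 0)
      = if (φ a = x ∧ φ b = y) then 1 else 0 := by
    intro φ; split_ifs <;> simp_all
  rw [sum_congr rfl (fun φ _ => e φ), sum_boole]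
  rw [card_pair hab] at h
  simp only [mem_insert, mem_singleton, forall_eq_or_imp, forall_eq, if_true, hab.symm,
    if_false] at h
  exact_mod_cast h

open Finset in
/-- If two different coordinates are tested, or one coordinate for two different values, both
tests succeed with probability at most `1 / |Q| ^ 2`. -/
theorem sum_indicator_mul_le {V Q : Type*} [Fintype V] [DecidableEq V] [Fintype Q] [Nonempty Q]
    [DecidableEq Q] {a b : V} {x y : Q} (h : a ≠ b ∨ x ≠ y) :
    ∑ φ : V → Q, (if φ a = x then (1 : ℝ) else 0) * (if φ b = y then (1 : ℝ) else 0)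
      ≤ (Fintype.card Q : ℝ) ^ Fintype.card V / (Fintype.card Q : ℝ) ^ 2 := by
  by_cases hab : a = b
  · subst hab
    have hxy : x ≠ y := by simpa using h
    refine (sum_nonpos fun φ _ => ?_).trans (by positivity)
    split_ifs with h1 h2 <;> simp_all
  · exact (sum_indicator_mul_eq hab x y).le

-- A Bonferroni bound: `a` marks hits and `b` counts conflicts. The left side is positive only if
-- there is exactly one hit and its conflict is below 1. It is quadratic in indicators, so its
-- average needs only pair probabilities.
open Finset in
theorem sum_mul_one_sub_le_indicator {U : Type*} [DecidableEq U] (D : Finset U) (a b : U → ℝ)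
    (ha : ∀ u, a u = 0 ∨ a u = 1) (hb : ∀ u, 0 ≤ b u) (P : Prop) [Decidable P]
    (hP : ¬ P → ∀ u ∈ D, a u = 1 → 1 ≤ b u) :
    ∑ u ∈ D, a u * (1 - ∑ u' ∈ D.erase u, a u' - b u) ≤ if P then 1 else 0 := by
  have ha0 : ∀ u, 0 ≤ a u := fun u => by rcases ha u with h | h <;> rw [h]; norm_num
  by_cases hex : ∃ u ∈ D, a u = 1 ∧ b u < 1
  · obtain ⟨u, hu, hau, hbu⟩ := hex
    have hP' : P := by
      by_contra hn
      exact absurd (hP hn u hu hau) (not_le.2 hbu)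
    rw [if_pos hP', ← add_sum_erase _ _ hu]
    have h1 : ∑ x ∈ D.erase u, a x * (1 - ∑ u' ∈ D.erase x, a u' - b x) ≤ 0 := by
      refine sum_nonpos fun x hx => ?_
      have : a u ≤ ∑ u' ∈ D.erase x, a u' :=
        single_le_sum (fun i _ => ha0 i) (mem_erase.2 ⟨(ne_of_mem_erase hx).symm, hu⟩)
      exact mul_nonpos_of_nonneg_of_nonpos (ha0 x) (by linarith [hb x])
    have h2 : 0 ≤ ∑ u' ∈ D.erase u, a u' := sum_nonneg fun i _ => ha0 i
    rw [hau]
    linarith [hb u]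
  · push Not at hex
    refine (sum_nonpos fun u hu => ?_).trans (by split_ifs <;> norm_num)
    rcases ha u with h | h
    · rw [h, zero_mul]
    · have h2 : 0 ≤ ∑ u' ∈ D.erase u, a u' := sum_nonneg fun i _ => ha0 i
      rw [h]
      linarith [hex u hu h]

open Finset in
/-- Vertices can be assigned to classes twice so that at least an eighth of the targets `c`
gets a vertex `u ∈ D c` that joins the class of `c` in the second assignment and whose partner
`π (cls c) u` joins it in the first. -/
theorem exists_assignment {V ι : Type*} [Fintype V] [DecidableEq V] [Fintype ι] {t : ℕ}
    (ht : 0 < t) (π : Fin t → V → V) (cls : ι → Fin t) (D : ι → Finset V)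
    (hD : ∀ c, t ≤ #(D c)) (hinj : ∀ c, Set.InjOn (π (cls c)) (D c)) :
    ∃ φ ψ : V → Fin t, ∃ g : Finset ι, Fintype.card ι ≤ 8 * #g ∧
      ∀ c ∈ g, ∃ u ∈ D c, φ (π (cls c) u) = cls c ∧ ψ u = cls c := by
  classical
  -- Exactly t candidates: enough for the main term, few enough for the pair corrections.
  choose D' hD' hcard using fun c => exists_subset_card_eq (hD c)
  have : NeZero t := ⟨ht.ne'⟩
  -- Only second coordinate 0 counts, so a candidate is hit with probability 1/(4t). Over t
  -- candidates this gives 1/4, minus at most 1/16 for double hits and 1/16 for conflicts with other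
  -- classes, leaving 1/8.
  let Q := Fin t × Fin 4
  let N : ℝ := (Fintype.card Q : ℝ) ^ Fintype.card V
  have hq : (Fintype.card Q : ℝ) = t * 4 := by simp [Q]
  have htR : (0 : ℝ) < t := by exact_mod_cast ht
  have hN : 0 < N := pow_pos (by rw [hq]; positivity) _
  let good : ι → (V → Q) → Prop := fun c φ => ∃ u ∈ D' c,
    φ (π (cls c) u) = (cls c, 0) ∧ ∀ i ∈ univ.erase (cls c), φ (π i u) ≠ (i, 0)
  have key : ∀ c, N / 8 ≤ ∑ φ : V → Q, if good c φ then (1 : ℝ) else 0 := by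
    intro c
    let a : (V → Q) → V → ℝ := fun φ u => if φ (π (cls c) u) = (cls c, 0) then 1 else 0
    let b : (V → Q) → V → ℝ := fun φ u =>
      ∑ i ∈ univ.erase (cls c), if φ (π i u) = (i, 0) then 1 else 0
    have h1 : ∀ φ : V → Q, ∑ u ∈ D' c, a φ u * (1 - ∑ u' ∈ (D' c).erase u, a φ u' - b φ u)
        ≤ if good c φ then (1 : ℝ) else 0 := by
      intro φ
      refine sum_mul_one_sub_le_indicator _ _ _ (fun u => ?_) (fun u => ?_) _ ?_
      · by_cases h : φ (π (cls c) u) = (cls c, 0) <;> simp [a, h]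
      · exact sum_nonneg fun i _ => by split_ifs <;> norm_num
      · intro hn u hu hau
        have hau' : φ (π (cls c) u) = (cls c, 0) := by
          by_contra h
          simp [a, h] at hau
        by_contra hb
        refine hn ⟨u, hu, hau', fun i hi hφ => hb ?_⟩
        have := single_le_sum (s := univ.erase (cls c))
          (f := fun i => if φ (π i u) = (i, 0) then (1 : ℝ) else 0)
          (fun i _ => by split_ifs <;> norm_num) hi
        rwa [if_pos hφ] at this
    refine le_trans ?_ (sum_le_sum fun φ _ => h1 φ)
    rw [sum_comm]
    have h2 : ∀ u ∈ D' c, N / (t * 8) ≤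
        ∑ φ : V → Q, a φ u * (1 - ∑ u' ∈ (D' c).erase u, a φ u' - b φ u) := by
      intro u hu
      have e : ∀ φ : V → Q, a φ u * (1 - ∑ u' ∈ (D' c).erase u, a φ u' - b φ u)
          = a φ u - ∑ u' ∈ (D' c).erase u, a φ u * a φ u'
            - ∑ i ∈ univ.erase (cls c), a φ u * (if φ (π i u) = (i, 0) then 1 else 0) := by
        intro φ
        simp only [b]
        rw [← mul_sum, ← mul_sum]
        ring
      rw [sum_congr rfl fun φ _ => e φ, sum_sub_distrib, sum_sub_distrib, sum_comm,
        sum_comm (t := univ.erase (cls c)), sum_indicator_eq]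
      have s1 : ∑ u' ∈ (D' c).erase u, ∑ φ : V → Q, a φ u * a φ u'
          ≤ t * (N / (t * 4) ^ 2) := by
        refine (sum_le_card_nsmul _ _ (N / (t * 4) ^ 2) fun u' hu' => ?_).trans ?_
        · rw [← hq]
          refine sum_indicator_mul_le (Or.inl fun h => ?_)
          exact ne_of_mem_erase hu' (hinj c (hD' c (mem_of_mem_erase hu')) (hD' c hu) h.symm)
        · rw [nsmul_eq_mul]
          gcongr
          exact (card_erase_le).trans (hcard c).le
      have s2 : ∑ i ∈ univ.erase (cls c), ∑ φ : V → Q,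
          a φ u * (if φ (π i u) = (i, 0) then 1 else 0) ≤ t * (N / (t * 4) ^ 2) := by
        refine (sum_le_card_nsmul _ _ (N / (t * 4) ^ 2) fun i hi => ?_).trans ?_
        · rw [← hq]
          refine sum_indicator_mul_le (Or.inr fun h => ?_)
          exact ne_of_mem_erase hi (congrArg Prod.fst h).symm
        · rw [nsmul_eq_mul]
          gcongr
          exact (card_erase_le).trans (by simp)
      have e3 : (t : ℝ) * (N / (t * 4) ^ 2) = N / (t * 16) := by field_simp; norm_num
      have e4 : N / (t * 8) = N / (t * 4) - N / (t * 16) - N / (t * 16) := by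
        field_simp; norm_num
      rw [e3] at s1 s2
      rw [show (Fintype.card Q : ℝ) ^ Fintype.card V = N from rfl, hq]
      linarith
    refine le_trans ?_ (card_nsmul_le_sum _ _ _ h2)
    rw [hcard, nsmul_eq_mul]
    refine le_of_eq ?_
    field_simp
  have hex : ∃ φ ∈ (univ : Finset (V → Q)), (Fintype.card ι : ℝ) / 8
      ≤ ∑ c : ι, if good c φ then (1 : ℝ) else 0 := by
    refine exists_le_of_sum_le univ_nonempty ?_
    rw [sum_comm, sum_const, card_univ, nsmul_eq_mul, Fintype.card_fun]
    calc ((Fintype.card Q ^ Fintype.card V : ℕ) : ℝ) * ((Fintype.card ι : ℝ) / 8)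
        = ∑ c : ι, N / 8 := by
          rw [sum_const, card_univ, nsmul_eq_mul, Nat.cast_pow]; ring
      _ ≤ _ := sum_le_sum fun c _ => key c
  obtain ⟨φ, -, hφ⟩ := hex
  -- The second assignment responds to the first: u joins a class whose partner of u was hit. At a
  -- good witness only one class qualifies, so the arbitrary choice is forced.
  refine ⟨fun v => (φ v).1,
    fun u => if h : ∃ i, φ (π i u) = (i, 0) then h.choose else 0,
    univ.filter fun c => good c φ, ?_, fun c hc => ?_⟩
  · rw [sum_boole] at hφ
    have : (Fintype.card ι : ℝ) ≤ 8 * #(univ.filter fun c => good c φ) := by linarith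
    exact_mod_cast this
  · obtain ⟨u, hu, h1, h2⟩ := (mem_filter.1 hc).2
    refine ⟨u, hD' c hu, by simp only [h1], ?_⟩
    have hx : ∃ i, φ (π i u) = (i, 0) := ⟨_, h1⟩
    simp only [dif_pos hx]
    by_contra hne
    exact h2 _ (mem_erase.2 ⟨hne, mem_univ _⟩) hx.choose_spec

/-! ### Vertex cuts, components and connectors -/

theorem exists_adj_not_mem_of_card_lt {V : Type*} [Fintype V] [DecidableEq V]
    {G : SimpleGraph V} {k : ℕ} (hG : IsVertexConnected G k) {S : Finset V} (hS : S.card < k)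
    {A : Set V} {a b : V} (haS : a ∉ S) (ha : a ∈ A) (hbS : b ∉ S) (hb : b ∉ A) :
    ∃ x y, G.Adj x y ∧ x ∉ S ∧ y ∉ S ∧ x ∈ A ∧ y ∉ A := by
  obtain ⟨p⟩ := (hG.2 S hS).preconnected ⟨a, haS⟩ ⟨b, hbS⟩
  obtain ⟨d, -, h1, h2⟩ := p.exists_boundary_dart {x | x.1 ∈ A} ha hb
  exact ⟨_, _, d.adj, d.fst.2, d.snd.2, h1, h2⟩

-- Deleting fewer than k neighbors cannot isolate v, since k < n leaves some other vertex to be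
-- reached.
open Finset Classical in
theorem IsVertexConnected.le_card_neighbors {V : Type*} [Fintype V]
    {G : SimpleGraph V} {k : ℕ} (hG : IsVertexConnected G k) (v : V) :
    k ≤ #{u | G.Adj v u} := by
  by_contra! h
  have h2 : #(insert v ({u | G.Adj v u} : Finset V)) < Fintype.card V :=
    (card_insert_le _ _).trans_lt (by have := hG.1; omega)
  obtain ⟨w, hw⟩ : ∃ w, w ∉ insert v ({u | G.Adj v u} : Finset V) := by
    by_contra! hw
    rw [eq_univ_of_forall hw, card_univ] at h2
    exact lt_irrefl _ h2
  simp only [mem_insert, mem_filter, mem_univ, true_and, not_or] at hw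
  obtain ⟨x, y, hxy, -, hy, rfl, -⟩ := exists_adj_not_mem_of_card_lt hG h (A := {v}) (a := v)
    (b := w) (by simp) (by simp) (by simpa using hw.2) (by simpa using hw.1)
  simp [hxy] at hy

/-- The components of the subgraph of `G` induced by `S`. -/
abbrev Component {V : Type*} (G : SimpleGraph V) (S : Finset V) : Type _ :=
  (G.induce {v : V | v ∈ S}).ConnectedComponent

/-- The vertex `u` has a neighbor in the component `C`. -/
def Touches {V : Type*} (G : SimpleGraph V) {S : Finset V} (u : V) (C : Component G S) : Prop :=
  ∃ a : {v : V | v ∈ S}, (G.induce {v : V | v ∈ S}).connectedComponentMk a = C ∧ G.Adj u a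

/-- The vertex `v` lies in the component `C`. -/
def InComponent {V : Type*} {G : SimpleGraph V} {S : Finset V} (v : V) (C : Component G S) :
    Prop :=
  ∃ h : v ∈ S, (G.induce {v : V | v ∈ S}).connectedComponentMk ⟨v, h⟩ = C

section
variable {V : Type*} {G : SimpleGraph V} {S : Finset V}

theorem InComponent.touches {u v : V} {C : Component G S} (h : InComponent v C)
    (huv : G.Adj u v) : Touches G u C :=
  ⟨⟨v, h.1⟩, h.2, huv⟩

theorem Touches.exists_inComponent {u : V} {C : Component G S} (h : Touches G u C) :
    ∃ v, InComponent v C ∧ G.Adj u v := by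
  obtain ⟨a, ha, h⟩ := h
  exact ⟨a.1, ⟨a.2, ha⟩, h⟩

theorem exists_inComponent (C : Component G S) : ∃ v, InComponent v C := by
  induction C using SimpleGraph.ConnectedComponent.ind with
  | h a => exact ⟨a.1, a.2, rfl⟩

theorem inComponent_of_mem {v : V} (h : v ∈ S) : ∃ C : Component G S, InComponent v C :=
  ⟨_, h, rfl⟩

theorem InComponent.of_adj {u v : V} {C : Component G S} (h : InComponent u C) (hv : v ∈ S)
    (huv : G.Adj u v) : InComponent v C := by
  obtain ⟨hu, rfl⟩ := h
  refine ⟨hv, SimpleGraph.ConnectedComponent.eq.2 (SimpleGraph.Adj.reachable ?_)⟩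
  exact huv.symm

theorem InComponent.unique {v : V} {C C' : Component G S} (h : InComponent v C)
    (h' : InComponent v C') : C = C' := by
  obtain ⟨_, rfl⟩ := h
  obtain ⟨_, rfl⟩ := h'
  rfl

theorem Touches.inComponent {u : V} {C : Component G S} (h : Touches G u C) (hu : u ∈ S) :
    InComponent u C := by
  obtain ⟨v, hv, huv⟩ := h.exists_inComponent
  exact hv.of_adj hu huv.symm

end

open Finset Classical in
/-- A component of a dominating set has many short or many long connectors to the rest: take a
maximal matching among the long ones. Its vertices and the short connectors form a cut. -/
theorem IsVertexConnected.exists_connectors_of_component {V : Type*} [Fintype V]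
    {G : SimpleGraph V} {k t : ℕ} (hG : IsVertexConnected G k) (htk : 3 * t ≤ k)
    {S : Finset V} (hS : ∀ v, ∃ u ∈ S, G.Adj v u) (C : Component G S) (hC : ∃ C', C' ≠ C) :
    (∃ D : Finset V, t ≤ #D ∧ ∀ u ∈ D, Touches G u C ∧ ∃ C' ≠ C, Touches G u C') ∨
    ∃ (D : Finset V) (m : V → V), t ≤ #D ∧ Set.InjOn m D ∧
      ∀ u ∈ D, (∀ C', Touches G u C' ↔ C' = C) ∧ G.Adj u (m u) ∧
        ∃ C' ≠ C, Touches G (m u) C' := by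
  set Z : Finset V := {u | u ∉ S ∧ Touches G u C ∧ ∃ C' ≠ C, Touches G u C'} with hZ
  have htouch : ∀ v, ∃ C' : Component G S, Touches G v C' := by
    intro v
    obtain ⟨u, hu, h⟩ := hS v
    obtain ⟨C', hC'⟩ := inComponent_of_mem (G := G) hu
    exact ⟨C', hC'.touches h⟩
  by_cases hZt : t ≤ #Z
  · exact Or.inl ⟨Z, hZt, fun u hu => (mem_filter.1 hu).2.2⟩
  refine Or.inr ?_
  have key : ∀ j ≤ t, ∃ (D : Finset V) (m : V → V), #D = j ∧ Set.InjOn m D ∧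
      ∀ u ∈ D, u ∉ S ∧ m u ∉ S ∧ (∀ C', Touches G u C' ↔ C' = C) ∧ G.Adj u (m u) ∧
        ∃ C' ≠ C, Touches G (m u) C' := by
    intro j
    induction j with
    | zero => exact fun _ => ⟨∅, id, by simp⟩
    | succ j ih =>
      intro hj
      obtain ⟨D, m, hcard, hinj, hD⟩ := ih (by omega)
      -- At most t - 1 short connectors and t - 1 matched pairs: fewer than 3t vertices.
      have hR : #(Z ∪ D ∪ D.image m) < k := by
        have h1 := card_union_le (Z ∪ D) (D.image m)
        have h2 := card_union_le Z D
        have h3 : #(D.image m) ≤ #D := card_image_le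
        omega
      set R := Z ∪ D ∪ D.image m with hRdef
      have hRS : ∀ v ∈ S, v ∉ R := by
        intro v hv hvR
        simp only [hRdef, mem_union, mem_image] at hvR
        rcases hvR with (h | h) | ⟨u, hu, rfl⟩
        · exact (mem_filter.1 h).2.1 hv
        · exact (hD v h).1 hv
        · exact (hD u hu).2.1 hv
      obtain ⟨C', hC'⟩ := hC
      obtain ⟨a, ha⟩ := exists_inComponent C
      obtain ⟨b, hb⟩ := exists_inComponent C'
      -- An edge leaving C together with its neighborhood extends the matching: x touches C and, not
      -- being in Z, no other component, while y does not touch C and so by domination touches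
      -- another one.
      obtain ⟨x, y, hxy, hxR, hyR, hx, hy⟩ := exists_adj_not_mem_of_card_lt hG hR
        (A := {v | InComponent v C ∨ Touches G v C}) (hRS a ha.1) (Or.inl ha) (hRS b hb.1)
        (by
          rintro (h | h)
          · exact hC' (hb.unique h)
          · exact hC' (hb.unique (h.inComponent hb.1)))
      simp only [Set.mem_ofPred_eq, not_or] at hx hy
      have hxC : ¬ InComponent x C := fun h => hy.2 (h.touches hxy.symm)
      have hxT : Touches G x C := hx.resolve_left hxC
      have hxS : x ∉ S := fun h => hxC (hxT.inComponent h)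
      have hyS : y ∉ S := by
        intro h
        obtain ⟨C₁, hC₁⟩ := inComponent_of_mem (G := G) h
        have hne : C₁ ≠ C := by
          rintro rfl
          exact hy.1 hC₁
        refine hxR ?_
        simp only [hRdef, mem_union]
        exact Or.inl (Or.inl (mem_filter.2
          ⟨mem_univ _, hxS, hxT, C₁, hne, hC₁.touches hxy⟩))
      have hxD : x ∉ D := fun h => hxR (by simp [hRdef, h])
      have hyD : y ∉ D.image m := fun h => hyR (by rw [hRdef]; exact mem_union_right _ h)
      have hm : ∀ u ∈ D, Function.update m x y u = m u := fun u hu =>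
        Function.update_of_ne (by rintro rfl; exact hxD hu) _ _
      refine ⟨insert x D, Function.update m x y, by rw [card_insert_of_notMem hxD, hcard], ?_, ?_⟩
      · rw [coe_insert, Set.injOn_insert (by simpa using hxD)]
        refine ⟨fun u hu v hv h => hinj hu hv ?_, ?_⟩
        · rwa [hm u hu, hm v hv] at h
        · rintro ⟨u, hu, h⟩
          rw [hm u hu, Function.update_self] at h
          exact hyD (mem_image.2 ⟨u, hu, h⟩)
      · intro u hu
        rcases mem_insert.1 hu with rfl | hu
        · rw [Function.update_self]
          refine ⟨hxS, hyS, fun C₁ => ⟨fun h => ?_, fun h => h ▸ hxT⟩, hxy, ?_⟩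
          · by_contra hne
            refine hxR ?_
            simp only [hRdef, mem_union]
            exact Or.inl (Or.inl (mem_filter.2 ⟨mem_univ _, hxS, hxT, C₁, hne, h⟩))
          · obtain ⟨C₁, hC₁⟩ := htouch y
            exact ⟨C₁, fun h => hy.2 (h ▸ hC₁), hC₁⟩
        · rw [hm u hu]
          exact hD u hu
  obtain ⟨D, m, hcard, hinj, hD⟩ := key t le_rfl
  exact ⟨D, m, hcard.ge, hinj, fun u hu => (hD u hu).2.2⟩

-- One partner map must serve all components. A long connector touches a single component, which
-- tells whose matching to follow; a short one touches two and is its own partner.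
open Finset Classical in
theorem IsVertexConnected.exists_connectors {V : Type*} [Fintype V]
    {G : SimpleGraph V} {k t : ℕ} (hG : IsVertexConnected G k) (htk : 3 * t ≤ k)
    {S : Finset V} (hS : ∀ v, ∃ u ∈ S, G.Adj v u) (hC : Nontrivial (Component G S)) :
    ∃ (π : V → V) (D : Component G S → Finset V), ∀ C, t ≤ #(D C) ∧ Set.InjOn π (D C) ∧
      ∀ u ∈ D C, Touches G u C ∧ ((∃ C' ≠ C, Touches G u C') ∨
        G.Adj u (π u) ∧ ∃ C' ≠ C, Touches G (π u) C') := by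
  have h := fun C : Component G S =>
    hG.exists_connectors_of_component htk hS C (exists_ne C)
  have h2 : ∀ C : Component G S, ∃ (D : Finset V) (m : V → V), t ≤ #D ∧
      ((∀ u ∈ D, Touches G u C ∧ ∃ C' ≠ C, Touches G u C') ∨
      (Set.InjOn m D ∧ ∀ u ∈ D, (∀ C', Touches G u C' ↔ C' = C) ∧ G.Adj u (m u) ∧
        ∃ C' ≠ C, Touches G (m u) C')) := by
    intro C
    rcases h C with ⟨D, h1, h2⟩ | ⟨D, m, h1, h2⟩
    · exact ⟨D, id, h1, Or.inl h2⟩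
    · exact ⟨D, m, h1, Or.inr h2⟩
  choose D m hDt hDm using h2
  refine ⟨fun u => if hu : ∃ C : Component G S, ∀ C', Touches G u C' ↔ C' = C
    then m hu.choose u else u, D, fun C => ⟨hDt C, ?_⟩⟩
  rcases hDm C with hs | ⟨hinj, hl⟩
  · have hπ : ∀ u ∈ D C, ¬ ∃ C : Component G S, ∀ C', Touches G u C' ↔ C' = C := by
      rintro u hu ⟨C₀, hC₀⟩
      obtain ⟨h1, C', hne, h2⟩ := hs u hu
      exact hne (((hC₀ _).1 h2).trans ((hC₀ _).1 h1).symm)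
    refine ⟨fun u hu v hv huv => ?_, fun u hu => ⟨(hs u hu).1, Or.inl (hs u hu).2⟩⟩
    simpa only [dif_neg (hπ u hu), dif_neg (hπ v hv)] using huv
  · have hπ : ∀ u ∈ D C, (if hu : ∃ C : Component G S, ∀ C', Touches G u C' ↔ C' = C
        then m hu.choose u else u) = m C u := by
      intro u hu
      have hx : ∃ C : Component G S, ∀ C', Touches G u C' ↔ C' = C := ⟨C, (hl u hu).1⟩
      rw [dif_pos hx]
      have : hx.choose = C := ((hl u hu).1 _).1 ((hx.choose_spec _).2 rfl)
      rw [this]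
    refine ⟨fun u hu v hv huv => hinj hu hv ?_, fun u hu => ⟨((hl u hu).1 C).2 rfl, Or.inr ?_⟩⟩
    · simp only [hπ u hu, hπ v hv] at huv
      exact huv
    · simp only [hπ u hu]
      exact (hl u hu).2

/-! ### Merging components -/

section
variable {V : Type*} {G : SimpleGraph V} {S S' : Finset V}

/-- The component of `G[S']` that contains a given component of `G[S]`, for `S ⊆ S'`. -/
def Component.map (h : S ⊆ S') (C : Component G S) : Component G S' :=
  SimpleGraph.ConnectedComponent.map
    (G.induceHomOfLE (s := {v | v ∈ S}) (s' := {v | v ∈ S'}) h).toHom C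

theorem InComponent.map {v : V} {C : Component G S} (hv : InComponent v C) (h : S ⊆ S') :
    InComponent v (C.map h) := by
  obtain ⟨hv, rfl⟩ := hv
  exact ⟨h hv, rfl⟩

theorem Touches.inComponent_map {u : V} {C : Component G S} (hu : Touches G u C) (h : S ⊆ S')
    (huS : u ∈ S') : InComponent u (C.map h) := by
  obtain ⟨v, hv, huv⟩ := hu.exists_inComponent
  exact (hv.map h).of_adj huS huv.symm

/-- Every added vertex has a neighbor in S, so no new component appears. -/
theorem Component.map_surjective (h : S ⊆ S') (hS : IsDominatingSet G S) :
    Function.Surjective (Component.map (G := G) h) := by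
  intro C'
  obtain ⟨v, hv⟩ := exists_inComponent C'
  by_cases hvS : v ∈ S
  · obtain ⟨C, hC⟩ := inComponent_of_mem (G := G) hvS
    exact ⟨C, (hC.map h).unique hv⟩
  · obtain ⟨u, hu, hvu⟩ := hS v hvS
    obtain ⟨C, hC⟩ := inComponent_of_mem (G := G) hu
    exact ⟨C, (hC.map h).unique (hv.of_adj (h hu) hvu)⟩

end

-- A fiber meeting g has at least two elements, so it loses at least half of its size on merging to
-- one point.
open Finset in
theorem two_mul_card_add_card_le {α β : Type*} [Fintype α] [Fintype β] {f : α → β}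
    (hf : Function.Surjective f) (g : Finset α) (hg : ∀ a ∈ g, ∃ b ≠ a, f b = f a) :
    2 * Fintype.card β + #g ≤ 2 * Fintype.card α := by
  classical
  have h1 : #g = ∑ b : β, #{a ∈ g | f a = b} :=
    card_eq_sum_card_fiberwise fun _ _ => mem_univ _
  have h2 : Fintype.card α = ∑ b : β, #{a | f a = b} :=
    card_eq_sum_card_fiberwise fun _ _ => mem_univ _
  have h3 : ∀ b : β, 2 + #{a ∈ g | f a = b} ≤ 2 * #{a | f a = b} := by
    intro b
    have hle : #{a ∈ g | f a = b} ≤ #{a | f a = b} :=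
      card_le_card (filter_subset_filter _ (subset_univ g))
    rcases eq_empty_or_nonempty ({a ∈ g | f a = b} : Finset α) with h | ⟨a, ha⟩
    · obtain ⟨a, ha⟩ := hf b
      have : 0 < #{a | f a = b} := card_pos.2 ⟨a, by simp [ha]⟩
      rw [h, card_empty]
      omega
    · obtain ⟨hag, hab⟩ := mem_filter.1 ha
      obtain ⟨a', hne, ha'⟩ := hg a hag
      have : 1 < #{a | f a = b} :=
        one_lt_card.2 ⟨a', by simp [ha', hab], a, by simp [hab], hne⟩
      omega
  calc 2 * Fintype.card β + #g = ∑ b : β, (2 + #{a ∈ g | f a = b}) := by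
        rw [sum_add_distrib, ← h1, sum_const, card_univ, smul_eq_mul, mul_comm]
    _ ≤ ∑ b : β, 2 * #{a | f a = b} := sum_le_sum fun b _ => h3 b
    _ = 2 * Fintype.card α := by rw [← mul_sum, ← h2]

/-! ### Layers and decreasing potentials -/

/-- Every vertex `v` joins the classes `φ v` and `ψ v`. -/
def addLayer {V : Type*} [Fintype V] [DecidableEq V] {t : ℕ} (S : Fin t → Finset V)
    (φ ψ : V → Fin t) (i : Fin t) : Finset V :=
  S i ∪ Finset.univ.filter fun v => φ v = i ∨ ψ v = i

section
variable {V : Type*} [Fintype V] [DecidableEq V] {t : ℕ} {S : Fin t → Finset V}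
  {φ ψ : V → Fin t}

theorem subset_addLayer (i : Fin t) : S i ⊆ addLayer S φ ψ i :=
  Finset.subset_union_left

theorem mem_addLayer_of_eq {i : Fin t} {v : V} (h : φ v = i ∨ ψ v = i) :
    v ∈ addLayer S φ ψ i :=
  Finset.mem_union_right _ (by simpa using h)

open Finset in
theorem overlap_addLayer_le (v : V) :
    #{i | v ∈ addLayer S φ ψ i} ≤ #{i | v ∈ S i} + 2 := by
  have : ({i | v ∈ addLayer S φ ψ i} : Finset (Fin t)) ⊆
      ({i | v ∈ S i} : Finset (Fin t)) ∪ {φ v, ψ v} := by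
    intro i
    simp only [addLayer, mem_filter, mem_univ, true_and, mem_union, mem_insert, mem_singleton]
    rintro (h | h | h)
    · exact Or.inl h
    · exact Or.inr (Or.inl h.symm)
    · exact Or.inr (Or.inr h.symm)
  refine (card_le_card this).trans ((card_union_le _ _).trans ?_)
  gcongr
  exact card_le_two

end

open Finset in
theorem exists_potential_eq_zero {V : Type*} [DecidableEq V] {t : ℕ}
    {P : (Fin t → Finset V) → Prop}
    {Φ : (Fin t → Finset V) → ℕ}
    (step : ∀ S, P S → ∃ S' : Fin t → Finset V, P S' ∧
      (∀ v, #{i | v ∈ S' i} ≤ #{i | v ∈ S i} + 2) ∧ 16 * Φ S' ≤ 15 * Φ S)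
    {S : Fin t → Finset V} (hS : P S) {L : ℕ} (hL : 15 ^ L * Φ S < 16 ^ L) :
    ∃ S' : Fin t → Finset V, P S' ∧ (∀ v, #{i | v ∈ S' i} ≤ #{i | v ∈ S i} + 2 * L) ∧
      Φ S' = 0 := by
  have key : ∀ l : ℕ, ∃ S' : Fin t → Finset V, P S' ∧
      (∀ v, #{i | v ∈ S' i} ≤ #{i | v ∈ S i} + 2 * l) ∧ 16 ^ l * Φ S' ≤ 15 ^ l * Φ S := by
    intro l
    induction l with
    | zero => exact ⟨S, hS, by simp⟩
    | succ l ih =>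
      obtain ⟨S₁, h1, h2, h3⟩ := ih
      obtain ⟨S₂, h4, h5, h6⟩ := step S₁ h1
      refine ⟨S₂, h4, fun v => ?_, ?_⟩
      · have := h2 v
        have := h5 v
        omega
      · calc 16 ^ (l + 1) * Φ S₂ = 16 ^ l * (16 * Φ S₂) := by ring
          _ ≤ 16 ^ l * (15 * Φ S₁) := by gcongr
          _ = 15 * (16 ^ l * Φ S₁) := by ring
          _ ≤ 15 * (15 ^ l * Φ S) := by gcongr
          _ = 15 ^ (l + 1) * Φ S := by ring
  obtain ⟨S', h1, h2, h3⟩ := key L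
  refine ⟨S', h1, h2, ?_⟩
  by_contra h
  have : 16 ^ L ≤ 16 ^ L * Φ S' := Nat.le_mul_of_pos_right _ (Nat.pos_of_ne_zero h)
  omega

-- Each vertex is its own partner, so only the second assignment matters. Neighbors are required
-- even for vertices inside the class, so that later every vertex touches a component.
open Finset Classical in
theorem IsVertexConnected.exists_domination_step {V : Type*} [Fintype V] [DecidableEq V]
    {G : SimpleGraph V} {k t : ℕ} (hG : IsVertexConnected G k) (ht : 0 < t) (htk : t ≤ k)
    (S : Fin t → Finset V) :
    ∃ S' : Fin t → Finset V, (∀ v, #{i | v ∈ S' i} ≤ #{i | v ∈ S i} + 2) ∧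
      16 * #{p : V × Fin t | ¬ ∃ u ∈ S' p.2, G.Adj p.1 u}
        ≤ 15 * #{p : V × Fin t | ¬ ∃ u ∈ S p.2, G.Adj p.1 u} := by
  let B : Finset (V × Fin t) := {p : V × Fin t | ¬ ∃ u ∈ S p.2, G.Adj p.1 u}
  obtain ⟨φ, ψ, g, hg, h⟩ := exists_assignment (ι := {p // p ∈ B}) ht (fun _ v => v)
    (fun p => p.1.2) (fun p => {u | G.Adj p.1.1 u})
    (fun p => htk.trans (hG.le_card_neighbors _)) (fun _ => Set.injOn_id _)
  refine ⟨addLayer S φ ψ, fun v => ?_, ?_⟩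
  · convert overlap_addLayer_le (S := S) (φ := φ) (ψ := ψ) v
  rw [Fintype.card_coe] at hg
  have hsub : ({p : V × Fin t | ¬ ∃ u ∈ addLayer S φ ψ p.2, G.Adj p.1 u} : Finset _)
      ⊆ B \ g.map (Function.Embedding.subtype _) := by
    intro p hp
    have hp := (mem_filter.1 hp).2
    refine mem_sdiff.2 ⟨mem_filter.2 ⟨mem_univ _, ?_⟩, fun hpg => ?_⟩
    · rintro ⟨u, hu, hpu⟩
      exact hp ⟨u, subset_addLayer _ hu, hpu⟩
    · obtain ⟨c, hc, rfl⟩ := mem_map.1 hpg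
      obtain ⟨u, hu, -, h2⟩ := h c hc
      exact hp ⟨u, mem_addLayer_of_eq (Or.inr h2), (mem_filter.1 hu).2⟩
  have hgB : g.map (Function.Embedding.subtype _) ⊆ B := by
    intro p hp
    obtain ⟨c, -, rfl⟩ := mem_map.1 hp
    exact c.2
  have h1 := card_le_card hsub
  have h2 := card_sdiff_add_card_eq_card hgB
  rw [card_map] at h2
  change 16 * _ ≤ 15 * #B
  omega

open Finset Classical in
theorem IsVertexConnected.exists_connection_step {V : Type*} [Fintype V] [DecidableEq V]
    [Nonempty V]
    {G : SimpleGraph V} {k t : ℕ} (hG : IsVertexConnected G k) (ht : 0 < t) (htk : 3 * t ≤ k)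
    (S : Fin t → Finset V) (hS : ∀ i v, ∃ u ∈ S i, G.Adj v u) :
    ∃ S' : Fin t → Finset V, (∀ i v, ∃ u ∈ S' i, G.Adj v u) ∧
      (∀ v, #{i | v ∈ S' i} ≤ #{i | v ∈ S i} + 2) ∧
      16 * ∑ i, (Nat.card (Component G (S' i)) - 1)
        ≤ 15 * ∑ i, (Nat.card (Component G (S i)) - 1) := by
  let _ : ∀ T : Finset V, Fintype (Component G T) := fun T => Fintype.ofFinite _
  have hex : ∀ i, ∃ (π : V → V) (D : Component G (S i) → Finset V),
      Nontrivial (Component G (S i)) → ∀ C, t ≤ #(D C) ∧ Set.InjOn π (D C) ∧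
      ∀ u ∈ D C, Touches G u C ∧ ((∃ C' ≠ C, Touches G u C') ∨
        G.Adj u (π u) ∧ ∃ C' ≠ C, Touches G (π u) C') := by
    intro i
    by_cases h : Nontrivial (Component G (S i))
    · obtain ⟨π, D, hD⟩ := hG.exists_connectors htk (hS i) h
      exact ⟨π, D, fun _ => hD⟩
    · exact ⟨id, fun _ => ∅, fun h' => absurd h' h⟩
  choose π D hD using hex
  -- Targets are the components of the disconnected classes; connected classes have no excess to
  -- remove.
  obtain ⟨φ, ψ, g, hg, h⟩ := exists_assignment
    (ι := Σ i : Fin t, {_C : Component G (S i) // Nontrivial (Component G (S i))}) ht π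
    (fun c => c.1) (fun c => D c.1 c.2.1) (fun c => (hD c.1 c.2.2 c.2.1).1)
    (fun c => (hD c.1 c.2.2 c.2.1).2.1)
  let S' := addLayer S φ ψ
  have hS' : ∀ i v, ∃ u ∈ S' i, G.Adj v u := fun i v => by
    obtain ⟨u, hu, hvu⟩ := hS i v
    exact ⟨u, subset_addLayer i hu, hvu⟩
  refine ⟨S', hS', fun v => ?_, ?_⟩
  · convert overlap_addLayer_le (S := S) (φ := φ) (ψ := ψ) v
  let g' : ∀ i, Finset (Component G (S i)) := fun i => {C | ∃ h, ⟨i, ⟨C, h⟩⟩ ∈ g}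
  have hgg' : #g ≤ ∑ i, #(g' i) := by
    rw [← card_sigma]
    refine card_le_card_of_injOn (fun x => ⟨x.1, x.2.1⟩) (fun x hx => ?_) ?_
    · exact mem_sigma.2 ⟨mem_univ _, mem_filter.2 ⟨mem_univ _, x.2.2, hx⟩⟩
    · rintro ⟨i, C, hC⟩ - ⟨j, C', hC'⟩ - hij
      simp only [Sigma.mk.injEq] at hij
      obtain ⟨rfl, hij⟩ := hij
      obtain rfl := eq_of_heq hij
      rfl
  have hmerge : ∀ i, 2 * Nat.card (Component G (S' i)) + #(g' i)
      ≤ 2 * Nat.card (Component G (S i)) := by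
    intro i
    have hsub : S i ⊆ S' i := subset_addLayer i
    rw [Nat.card_eq_fintype_card, Nat.card_eq_fintype_card]
    refine two_mul_card_add_card_le (Component.map_surjective hsub fun v _ => hS i v) _ ?_
    intro C hC
    obtain ⟨hnt, hCg⟩ := (mem_filter.1 hC).2
    obtain ⟨u, hu, h1, h2⟩ := h _ hCg
    obtain ⟨-, -, hDu⟩ := hD i hnt C
    obtain ⟨huC, hu2⟩ := hDu u hu
    have huS : u ∈ S' i := mem_addLayer_of_eq (Or.inr h2)
    have hwS : π i u ∈ S' i := mem_addLayer_of_eq (Or.inl h1)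
    have huC' := huC.inComponent_map hsub huS
    rcases hu2 with ⟨C', hne, hC'⟩ | ⟨huw, C', hne, hC'⟩
    · exact ⟨C', hne, (hC'.inComponent_map hsub huS).unique huC'⟩
    · exact ⟨C', hne, (hC'.inComponent_map hsub hwS).unique (huC'.of_adj hwS huw)⟩
  have hpos : ∀ i, 0 < Nat.card (Component G (S' i)) := by
    intro i
    obtain ⟨v⟩ := ‹Nonempty V›
    obtain ⟨u, hu, -⟩ := hS' i v
    obtain ⟨C, -⟩ := inComponent_of_mem (G := G) hu
    have : Nonempty (Component G (S' i)) := ⟨C⟩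
    exact Nat.card_pos
  have hι : ∑ i, (Nat.card (Component G (S i)) - 1) ≤ 8 * #g := by
    refine le_trans ?_ hg
    rw [Fintype.card_sigma]
    refine sum_le_sum fun i _ => ?_
    by_cases hnt : Nontrivial (Component G (S i))
    · rw [Fintype.card_congr (Equiv.subtypeUnivEquiv fun _ => hnt), Nat.card_eq_fintype_card]
      omega
    · have : Nat.card (Component G (S i)) ≤ 1 := by
        rw [not_nontrivial_iff_subsingleton] at hnt
        exact Finite.card_le_one_iff_subsingleton.2 hnt
      omega
  -- Merging removes at least half a component per success, and successes number at least an eighth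
  -- of the excess: the factor is 1 - 1/16.
  have hsum : ∑ i, (16 * (Nat.card (Component G (S' i)) - 1) + 8 * #(g' i))
      ≤ ∑ i, 16 * (Nat.card (Component G (S i)) - 1) := by
    refine sum_le_sum fun i _ => ?_
    have := hmerge i
    have := hpos i
    omega
  rw [sum_add_distrib, ← mul_sum, ← mul_sum, ← mul_sum] at hsum
  omega

theorem isCDS_of_card_component_le_one {V : Type*} [Finite V] [Nonempty V] {G : SimpleGraph V}
    {S : Finset V} (hS : ∀ v, ∃ u ∈ S, G.Adj v u) (h : Nat.card (Component G S) ≤ 1) :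
    IsCDS G S := by
  refine ⟨fun v _ => hS v, ?_⟩
  have hsub : Subsingleton (Component G S) := Finite.card_le_one_iff_subsingleton.1 h
  obtain ⟨v⟩ := ‹Nonempty V›
  obtain ⟨u, hu, -⟩ := hS v
  exact { preconnected := fun a b => SimpleGraph.ConnectedComponent.eq.1 (Subsingleton.elim _ _)
          nonempty := ⟨⟨u, hu⟩⟩ }

open Finset in
theorem IsVertexConnected.exists_isCDS_family {V : Type*} [Fintype V] [DecidableEq V]
    {G : SimpleGraph V} {k t L : ℕ} (hG : IsVertexConnected G k) (htk : 3 * t ≤ k)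
    (hL : 15 ^ L * Fintype.card V ^ 2 < 16 ^ L) :
    ∃ S : Fin t → Finset V, (∀ i, IsCDS G (S i)) ∧ ∀ v, #{i | v ∈ S i} ≤ 4 * L := by
  classical
  rcases Nat.eq_zero_or_pos t with rfl | ht
  · exact ⟨fun _ => ∅, fun i => i.elim0, fun v => by simp⟩
  have htn : t ≤ Fintype.card V := by have := hG.1; omega
  have : Nonempty V := Fintype.card_pos_iff.1 (by have := hG.1; omega)
  obtain ⟨S₁, -, ho₁, h₁⟩ := exists_potential_eq_zero (P := fun _ => True) (L := L)
    (Φ := fun S => #{p : V × Fin t | ¬ ∃ u ∈ S p.2, G.Adj p.1 u})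
    (fun S _ => by
      obtain ⟨S', h⟩ := hG.exists_domination_step ht (by omega) S
      refine ⟨S', trivial, ?_⟩
      convert h)
    (S := fun _ => ∅) trivial (by
      refine lt_of_le_of_lt (Nat.mul_le_mul_left _ ((card_le_univ _).trans ?_)) hL
      rw [Fintype.card_prod, Fintype.card_fin, pow_two]
      exact Nat.mul_le_mul_left _ htn)
  have hdom : ∀ i v, ∃ u ∈ S₁ i, G.Adj v u := by
    intro i v
    by_contra hn
    exact notMem_empty (v, i) (card_eq_zero.1 h₁ ▸ mem_filter.2 ⟨mem_univ _, hn⟩)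
  obtain ⟨S₂, hdom₂, ho₂, h₂⟩ := exists_potential_eq_zero (L := L)
    (P := fun S : Fin t → Finset V => ∀ i v, ∃ u ∈ S i, G.Adj v u)
    (Φ := fun S => ∑ i, (Nat.card (Component G (S i)) - 1))
    (fun S hS => by
      obtain ⟨S', h⟩ := hG.exists_connection_step ht htk S hS
      refine ⟨S', ?_⟩
      convert h)
    (S := S₁) hdom (by
      refine lt_of_le_of_lt (Nat.mul_le_mul_left _ ?_) hL
      calc ∑ i, (Nat.card (Component G (S₁ i)) - 1) ≤ ∑ _i : Fin t, Fintype.card V := by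
            refine sum_le_sum fun i _ => (Nat.sub_le _ _).trans ?_
            refine (Nat.card_le_card_of_surjective
              (G.induce {v | v ∈ S₁ i}).connectedComponentMk Quot.mk_surjective).trans ?_
            rw [← Nat.card_eq_fintype_card]
            exact Finite.card_subtype_le _
        _ ≤ Fintype.card V ^ 2 := by
            rw [sum_const, card_univ, Fintype.card_fin, smul_eq_mul, pow_two]
            exact Nat.mul_le_mul_right _ htn)
  refine ⟨S₂, fun i => isCDS_of_card_component_le_one (hdom₂ i) ?_, fun v => ?_⟩
  · have := sum_eq_zero_iff.1 h₂ i (mem_univ _)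
    omega
  · have h1 := ho₁ v
    have h2 := ho₂ v
    simp only [notMem_empty, filter_false, card_empty] at h1
    omega

/-! ### From classes to k distinct small sets -/

theorem IsCDS.superset {V : Type*} {G : SimpleGraph V} {S S' : Finset V} (hS : IsCDS G S)
    (h : S ⊆ S') : IsCDS G S' := by
  refine ⟨fun v hv => ?_, ?_⟩
  · obtain ⟨u, hu, huv⟩ := hS.1 v fun hvS => hv (h hvS)
    exact ⟨u, h hu, huv⟩
  · have : Subsingleton (Component G S) := hS.2.preconnected.subsingleton_connectedComponent
    have : Subsingleton (Component G S') := (Component.map_surjective h hS.1).subsingleton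
    obtain ⟨v⟩ := hS.2.nonempty
    exact { preconnected := fun a b => SimpleGraph.ConnectedComponent.eq.1 (Subsingleton.elim _ _)
            nonempty := ⟨⟨v.1, h v.2⟩⟩ }

open Finset in
/-- Adding one vertex to each set makes a family of small sets with small overlap distinct,
without adding any vertex to more than `b` sets. -/
theorem exists_injective_insert {V ι : Type*} [Fintype V] [DecidableEq V] [Fintype ι]
    {S : ι → Finset V} {o b m : ℕ} (hb : 0 < b) (hne : ∀ i, (S i).Nonempty)
    (ho : ∀ v, #{i | v ∈ S i} ≤ o) (hm : Fintype.card ι ≤ b * m)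
    (hn : ∀ i, #(S i) + m + (o + b) < Fintype.card V) :
    ∃ a : ι → V, Function.Injective (fun i => insert (a i) (S i)) ∧
      ∀ v, #{i | a i = v} ≤ b := by
  classical
  have key : ∀ s : Finset ι, ∃ a : ι → V, Set.InjOn (fun i => insert (a i) (S i)) s ∧
      ∀ v, #{i ∈ s | a i = v} ≤ b := by
    intro s
    induction s using Finset.induction_on with
    | empty => exact ⟨fun i => (hne i).choose, by simp, by simp⟩
    | insert j s hj ih =>
      obtain ⟨a, hinj, ha⟩ := ih
      -- Besides S j, the new vertex must avoid F₂ (used up b times) and F₃ (giving a set already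
      -- present). Distinct elements of F₃ give distinct sets through a fixed x in S j, whence the
      -- bound o + b.
      let F₂ : Finset V := {v | b ≤ #{i ∈ s | a i = v}}
      let F₃ : Finset V := {v ∈ (S j)ᶜ | ∃ i ∈ s, insert v (S j) = insert (a i) (S i)}
      have h2 : #F₂ ≤ m := by
        refine Nat.le_of_mul_le_mul_left ?_ hb
        calc b * #F₂ = ∑ v ∈ F₂, b := by rw [sum_const, smul_eq_mul, mul_comm]
          _ ≤ ∑ v ∈ F₂, #{i ∈ s | a i = v} := sum_le_sum fun v hv => (mem_filter.1 hv).2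
          _ ≤ ∑ v : V, #{i ∈ s | a i = v} := sum_le_univ_sum_of_nonneg (by simp)
          _ = #s := (card_eq_sum_card_fiberwise fun _ _ => mem_univ _).symm
          _ ≤ b * m := (card_le_univ s).trans hm
      obtain ⟨x, hx⟩ := hne j
      have h3 : #F₃ ≤ o + b := by
        have hinjF : Set.InjOn (fun v => insert v (S j)) F₃ := by
          intro v hv w hw hvw
          have hv' := mem_compl.1 (mem_filter.1 hv).1
          have : v ∈ insert w (S j) := by
            rw [← show insert v (S j) = insert w (S j) from hvw]
            exact mem_insert_self _ _
          exact (mem_insert.1 this).resolve_right hv'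
        have hsub : F₃.image (fun v => insert v (S j)) ⊆
            (({i | x ∈ S i} : Finset ι) ∪ {i ∈ s | a i = x}).image
              fun i => insert (a i) (S i) := by
          intro T hT
          obtain ⟨v, hv, rfl⟩ := mem_image.1 hT
          obtain ⟨-, i, hi, hiv⟩ := mem_filter.1 hv
          refine mem_image.2 ⟨i, ?_, hiv.symm⟩
          have : x ∈ insert (a i) (S i) := hiv ▸ mem_insert_of_mem hx
          rcases mem_insert.1 this with h | h
          · exact mem_union_right _ (mem_filter.2 ⟨hi, h.symm⟩)
          · exact mem_union_left _ (mem_filter.2 ⟨mem_univ _, h⟩)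
        calc #F₃ = #(F₃.image fun v => insert v (S j)) := (card_image_of_injOn hinjF).symm
          _ ≤ _ := card_le_card hsub
          _ ≤ _ := card_image_le
          _ ≤ _ := card_union_le _ _
          _ ≤ o + b := add_le_add (ho x) (ha x)
      obtain ⟨v, hv⟩ : ∃ v, v ∉ S j ∪ F₂ ∪ F₃ := by
        by_contra! hall
        have h4 := card_univ (α := V)
        rw [← eq_univ_of_forall hall] at h4
        have h5 := card_union_le (S j ∪ F₂) F₃
        have h6 := card_union_le (S j) F₂
        have := hn j
        omega
      simp only [mem_union, not_or] at hv
      obtain ⟨⟨hvS, hv2⟩, hv3⟩ := hv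
      have hup : ∀ i ∈ s, Function.update a j v i = a i := fun i hi =>
        Function.update_of_ne (by rintro rfl; exact hj hi) _ _
      refine ⟨Function.update a j v, ?_, fun w => ?_⟩
      · rw [coe_insert, Set.injOn_insert (by simpa using hj)]
        refine ⟨fun i hi i' hi' h => hinj hi hi' ?_, ?_⟩
        · simpa only [hup i hi, hup i' hi'] using h
        · rintro ⟨i, hi, h⟩
          simp only [hup i hi, Function.update_self] at h
          exact hv3 (mem_filter.2 ⟨mem_compl.2 hvS, i, hi, h.symm⟩)
      · rw [filter_insert, Function.update_self,
          filter_congr fun i hi => by rw [hup i hi]]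
        split_ifs with hvw
        · subst hvw
          have : #{i ∈ s | a i = v} < b := by
            by_contra! h
            exact hv2 (mem_filter.2 ⟨mem_univ _, h⟩)
          exact (card_insert_le _ _).trans this
        · exact ha w
  obtain ⟨a, h1, h2⟩ := key univ
  exact ⟨a, by simpa [Set.injOn_univ] using h1, h2⟩

open Finset in
theorem IsVertexConnected.exists_isCDS_finset {V : Type*} [Fintype V] [DecidableEq V]
    {G : SimpleGraph V} {k L : ℕ} (hG : IsVertexConnected G k) (hLpos : 0 < L)
    (hk : 96 * L + 200 ≤ k) (hL : 15 ^ L * Fintype.card V ^ 2 < 16 ^ L) :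
    ∃ F : Finset (Finset V), #F = k ∧ (∀ τ ∈ F, IsCDS G τ) ∧
      (∀ τ ∈ F, #τ * k ≤ 33 * (L * Fintype.card V)) ∧
      ∀ v, #{τ ∈ F | v ∈ τ} ≤ 32 * L + 24 := by
  set n := Fintype.card V with hn
  have hkn : k < n := hG.1
  obtain ⟨t, ht⟩ : ∃ t, t = k / 3 := ⟨_, rfl⟩
  obtain ⟨S, hS, hov⟩ := hG.exists_isCDS_family (t := t) (by omega) hL
  -- The light classes: average size is at most 4Ln/t, so by Markov at least half of the classes
  -- qualify.
  let T : Finset (Fin t) := {i | #(S i) * t ≤ 8 * (L * n)}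
  have hT : t ≤ 2 * #T := by
    have h1 : ∑ i, #(S i) ≤ n * (4 * L) := by
      calc ∑ i, #(S i) = ∑ v : V, #{i | v ∈ S i} := by
            have := sum_card_bipartiteAbove_eq_sum_card_bipartiteBelow
              (s := (univ : Finset (Fin t))) (t := (univ : Finset V)) (fun i v => v ∈ S i)
            simpa [bipartiteAbove, bipartiteBelow] using this
        _ ≤ ∑ _v : V, 4 * L := sum_le_sum fun v _ => hov v
        _ = n * (4 * L) := by rw [sum_const, card_univ, smul_eq_mul]
    have h2 : #Tᶜ * (8 * (L * n)) ≤ t * (n * (4 * L)) := by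
      calc #Tᶜ * (8 * (L * n)) = ∑ i ∈ Tᶜ, 8 * (L * n) := by rw [sum_const, smul_eq_mul]
        _ ≤ ∑ i ∈ Tᶜ, #(S i) * t := by
            refine sum_le_sum fun i hi => ?_
            have := mem_compl.1 hi
            simp only [T, mem_filter, mem_univ, true_and, not_le] at this
            exact this.le
        _ ≤ ∑ i, #(S i) * t := sum_le_univ_sum_of_nonneg (by simp)
        _ = t * ∑ i, #(S i) := by rw [← sum_mul, mul_comm]
        _ ≤ t * (n * (4 * L)) := Nat.mul_le_mul_left _ h1
    have h3 : 2 * #Tᶜ ≤ t := by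
      refine Nat.le_of_mul_le_mul_right (c := 4 * (L * n)) ?_
        (Nat.mul_pos (by norm_num) (Nat.mul_pos hLpos (by omega)))
      calc 2 * #Tᶜ * (4 * (L * n)) = #Tᶜ * (8 * (L * n)) := by ring
        _ ≤ _ := h2
        _ = _ := by ring
    have h4 := card_add_card_compl T
    rw [Fintype.card_fin] at h4
    omega
  have hTt : #T ≤ t := (card_le_univ T).trans (by simp)
  have hsize : ∀ i ∈ T, 4 * #(S i) ≤ n := by
    intro i hi
    have h := (mem_filter.1 hi).2
    refine Nat.le_of_mul_le_mul_right (c := 8 * L) ?_ (by positivity)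
    calc 4 * #(S i) * (8 * L) = #(S i) * (32 * L) := by ring
      _ ≤ #(S i) * t := Nat.mul_le_mul_left _ (by omega)
      _ ≤ 8 * (L * n) := h
      _ = n * (8 * L) := by ring
  have hov' : ∀ v, #{p : T × Fin 8 | v ∈ S p.1} ≤ 32 * L := by
    intro v
    calc #{p : T × Fin 8 | v ∈ S p.1}
        ≤ #(({i | v ∈ S i} : Finset (Fin t)) ×ˢ (univ : Finset (Fin 8))) := by
          refine card_le_card_of_injOn (fun p => (p.1.1, p.2)) (fun p hp => ?_) ?_
          · exact mem_product.2
              ⟨mem_filter.2 ⟨mem_univ _, (mem_filter.1 hp).2⟩, mem_univ _⟩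
          · rintro ⟨p, x⟩ - ⟨q, y⟩ - h
            simp only [Prod.mk.injEq] at h
            exact Prod.ext (Subtype.ext h.1) h.2
      _ ≤ 4 * L * 8 := by
          rw [card_product, card_univ, Fintype.card_fin]
          exact Nat.mul_le_mul_right _ (hov v)
      _ = 32 * L := by ring
  have hcard : Fintype.card (T × Fin 8) = #T * 8 := by simp
  -- Eight copies of at least t/2 classes give 4t ≥ k sets. Each has at most n/4 vertices because
  -- 32L ≤ t, which leaves room for the n/4 + 32L + 24 forbidden vertices.
  obtain ⟨a, hinj, ha⟩ := exists_injective_insert (S := fun p : T × Fin 8 => S p.1)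
    (o := 32 * L) (b := 24) (m := n / 4) (by norm_num)
    (fun p => by
      obtain ⟨v⟩ := (hS p.1).2.nonempty
      exact ⟨v.1, v.2⟩)
    hov' (by rw [hcard]; omega)
    (fun p => by
      have := hsize p.1 p.1.2
      omega)
  let f : T × Fin 8 → Finset V := fun p => insert (a p) (S p.1)
  obtain ⟨F, hF, hFk⟩ := exists_subset_card_eq (s := univ.image f) (n := k) (by
    rw [card_image_of_injective _ hinj, card_univ, hcard]
    omega)
  have hFf : ∀ τ ∈ F, ∃ p, f p = τ := fun τ hτ => by simpa using hF hτ
  refine ⟨F, hFk, fun τ hτ => ?_, fun τ hτ => ?_, fun v => ?_⟩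
  · obtain ⟨p, rfl⟩ := hFf τ hτ
    exact (hS p.1).superset (subset_insert _ _)
  · obtain ⟨p, rfl⟩ := hFf τ hτ
    calc #(f p) * k ≤ (#(S p.1) + 1) * k := Nat.mul_le_mul_right _ (card_insert_le _ _)
      _ = #(S p.1) * k + k := by ring
      _ ≤ #(S p.1) * (4 * t) + L * n := by
          gcongr
          · omega
          · exact hkn.le.trans (Nat.le_mul_of_pos_left _ hLpos)
      _ = 4 * (#(S p.1) * t) + L * n := by ring
      _ ≤ 4 * (8 * (L * n)) + L * n := by
          have := (mem_filter.1 p.1.2).2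
          gcongr
      _ = 33 * (L * n) := by ring
  · have hsub : {τ ∈ F | v ∈ τ} ⊆
        (({p | v ∈ S p.1} : Finset (T × Fin 8)) ∪ ({p | a p = v} : Finset (T × Fin 8))).image f := by
      intro τ hτ
      obtain ⟨hτF, hv⟩ := mem_filter.1 hτ
      obtain ⟨p, rfl⟩ := hFf τ hτF
      refine mem_image_of_mem _ ?_
      rcases mem_insert.1 hv with h | h
      · exact mem_union_right _ (mem_filter.2 ⟨mem_univ _, h.symm⟩)
      · exact mem_union_left _ (mem_filter.2 ⟨mem_univ _, h⟩)
    calc _ ≤ _ := card_le_card hsub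
      _ ≤ _ := card_image_le
      _ ≤ _ := card_union_le _ _
      _ ≤ 32 * L + 24 := add_le_add (hov' v) (ha v)

-- Removing fewer than k vertices leaves a CDS, as every vertex keeps a neighbor. Complements of
-- singletons suffice, except for k = 1, where nothing may be removed.
open Finset in
theorem IsVertexConnected.exists_isCDS_finset_card_eq {V : Type*} [Fintype V] [DecidableEq V]
    {G : SimpleGraph V} {k : ℕ} (hk : 1 ≤ k) (hG : IsVertexConnected G k) :
    ∃ F : Finset (Finset V), #F = k ∧ ∀ τ ∈ F, IsCDS G τ := by
  classical
  have hcompl : ∀ S : Finset V, #S < k → IsCDS G Sᶜ := by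
    intro S hS
    refine ⟨fun v _ => ?_, ?_⟩
    · by_contra! hn
      have h1 := hG.le_card_neighbors v
      have h2 : ({u | G.Adj v u} : Finset V) ⊆ S := fun u hu => by
        by_contra h
        exact hn u (mem_compl.2 h) (mem_filter.1 hu).2
      have := card_le_card h2
      omega
    · have : {v : V | v ∈ Sᶜ} = {v | v ∉ S} := by ext; simp
      rw [this]
      exact hG.2 S hS
  rcases hk.eq_or_lt with rfl | hk
  · exact ⟨{∅ᶜ}, card_singleton _, fun τ hτ => by
      rw [mem_singleton.1 hτ]
      exact hcompl ∅ (by simp)⟩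
  · obtain ⟨F, hF, hFk⟩ := exists_subset_card_eq
      (s := univ.image fun v : V => ({v} : Finset V)ᶜ) (n := k) (by
        rw [card_image_of_injective _ fun v w h => singleton_injective (compl_injective h),
          card_univ]
        exact hG.1.le)
    refine ⟨F, hFk, fun τ hτ => ?_⟩
    obtain ⟨v, -, rfl⟩ := mem_image.1 (hF hτ)
    exact hcompl _ (by simpa using hk)

/-! ### Packing weights and constants -/

open Finset in
theorem exists_isCDSPacking_of_overlap_le {V : Type*} [Fintype V] [DecidableEq V]
    {G : SimpleGraph V} {F : Finset (Finset V)} (hF : ∀ τ ∈ F, IsCDS G τ) {Λ : ℝ} (hΛ : 0 < Λ)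
    (hov : ∀ v, (#{τ ∈ F | v ∈ τ} : ℝ) ≤ Λ) :
    ∃ x : Finset V → ℝ, IsCDSPacking G x ∧ (∀ τ ∈ cdsFinset G, x τ ≠ 0 → τ ∈ F) ∧
      cdsPackingSize G x = #F / Λ := by
  have hsub : F ⊆ cdsFinset G := fun τ hτ => by simpa [cdsFinset] using hF τ hτ
  have hsum : ∀ A B : Finset (Finset V), A ⊆ B → (∀ τ ∈ B, τ ∈ F → τ ∈ A) → A ⊆ F →
      ∑ τ ∈ B, (if τ ∈ F then Λ⁻¹ else 0) = #A / Λ := by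
    intro A B hAB hBA hAF
    rw [← sum_subset hAB fun τ hB hA => if_neg fun h => hA (hBA τ hB h),
      sum_congr rfl fun τ hτ => if_pos (hAF hτ), sum_const, nsmul_eq_mul, div_eq_mul_inv]
  refine ⟨fun τ => if τ ∈ F then Λ⁻¹ else 0, ⟨fun τ _ => ?_, fun v => ?_⟩, fun τ _ h => ?_, ?_⟩
  · dsimp only
    split_ifs <;> positivity
  · rw [hsum {τ ∈ F | v ∈ τ} _ (filter_subset_filter _ hsub)
      (fun τ hτ hF => mem_filter.2 ⟨hF, (mem_filter.1 hτ).2⟩) (filter_subset _ _)]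
    exact (div_le_one hΛ).2 (hov v)
  · by_contra hn
    exact h (if_neg hn)
  · exact hsum F _ hsub (fun _ _ h => h) subset_rfl

theorem exists_pow_mul_sq_lt_pow {n : ℕ} (hn : 2 ≤ n) :
    ∃ L : ℕ, 0 < L ∧ 15 ^ L * n ^ 2 < 16 ^ L ∧ Real.log n ≤ L ∧
      (L : ℝ) ≤ 35 * Real.log n := by
  have hn0 : (0 : ℝ) < n := by positivity
  have hlog : (0.69 : ℝ) ≤ Real.log n := by
    have := Real.log_le_log (by norm_num) (show (2 : ℝ) ≤ n by exact_mod_cast hn)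
    linarith [Real.log_two_gt_d9]
  -- Since (15/16)^L ≤ exp(-L/16), any L > 32 log n beats n².
  refine ⟨⌊33 * Real.log n⌋₊ + 1, Nat.succ_pos _, ?_, ?_, ?_⟩
  · set L := ⌊33 * Real.log n⌋₊ + 1
    have hL : 33 * Real.log n < L := by
      simpa [L] using Nat.lt_floor_add_one (33 * Real.log n)
    have h1 : (15 / 16 : ℝ) ^ L ≤ Real.exp (-(1 / 16) * L) := by
      rw [mul_comm, Real.exp_nat_mul]
      gcongr
      linarith [Real.add_one_le_exp (-(1 / 16) : ℝ)]
    have h2 : (n : ℝ) ^ 2 = Real.exp (2 * Real.log n) := by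
      rw [← Nat.cast_ofNat (R := ℝ) (n := 2), Real.exp_nat_mul, Real.exp_log hn0]
    have h3 : (15 / 16 : ℝ) ^ L * n ^ 2 < 1 := by
      rw [h2]
      calc _ ≤ Real.exp (-(1 / 16) * L) * Real.exp (2 * Real.log n) := by gcongr
        _ = Real.exp (-(1 / 16) * L + 2 * Real.log n) := (Real.exp_add _ _).symm
        _ < 1 := Real.exp_lt_one_iff.2 (by linarith)
    rw [div_pow, div_mul_eq_mul_div, div_lt_one (by positivity)] at h3
    exact_mod_cast h3
  · push_cast
    linarith [Nat.lt_floor_add_one (33 * Real.log n)]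
  · push_cast
    linarith [Nat.floor_le (show 0 ≤ 33 * Real.log n by linarith)]

theorem theorem1 :
    ∃ c C : ℝ, 0 < c ∧ 0 < C ∧
      ∀ (V : Type u) [Fintype V] [DecidableEq V] (G : SimpleGraph V) (k : ℕ),
        1 ≤ k → IsVertexConnected G k →
        -- a collection of `k` small CDSs with small overlap at every node
        ∃ F : Finset (Finset V),
          F.card = k ∧
          (∀ τ ∈ F, IsCDS G τ) ∧
          (∀ τ ∈ F, (τ.card : ℝ) ≤
            C * (Fintype.card V * Real.log (Fintype.card V) / k)) ∧
          (∀ v : V, ((F.filter (fun τ => v ∈ τ)).card : ℝ) ≤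
            C * Real.log (Fintype.card V)) ∧
          -- and a large CDS packing that uses only CDSs of this collection
          ∃ x : Finset V → ℝ,
            IsCDSPacking G x ∧
            (∀ τ ∈ cdsFinset G, x τ ≠ 0 → τ ∈ F) ∧
            c * (k / Real.log (Fintype.card V) + 1) ≤ cdsPackingSize G x := by
  refine ⟨1 / 10000, 5000, by norm_num, by norm_num, fun V _ _ G k hk hG => ?_⟩
  have hkn : k < Fintype.card V := hG.1
  obtain ⟨L, hL0, hL, hlogL, hLlog⟩ := exists_pow_mul_sq_lt_pow (n := Fintype.card V) (by omega)
  set n := Fintype.card V with hn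
  set l := Real.log n with hl
  have hlog : (0.69 : ℝ) ≤ l := by
    have := Real.log_le_log (by norm_num) (show (2 : ℝ) ≤ n by exact_mod_cast (by omega : 2 ≤ n))
    linarith [Real.log_two_gt_d9]
  have hl0 : 0 < l := by linarith
  have hk0 : (0 : ℝ) < k := by exact_mod_cast hk
  have hkn' : (k : ℝ) ≤ n := by exact_mod_cast hkn.le
  -- Below this threshold k ≤ 4000 log n, so the size and overlap bounds hold for any k CDSs and the
  -- packing only needs constant size.
  rcases le_total (96 * L + 200) k with hbig | hsmall
  · obtain ⟨F, hFk, hF, hsize, hov⟩ := hG.exists_isCDS_finset hL0 hbig hL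
    have hov' : ∀ v : V, ((F.filter (fun τ => v ∈ τ)).card : ℝ) ≤ 5000 * l := by
      intro v
      have : ((F.filter (fun τ => v ∈ τ)).card : ℝ) ≤ 32 * L + 24 := by exact_mod_cast hov v
      linarith
    obtain ⟨x, hx, hxF, hxs⟩ :=
      exists_isCDSPacking_of_overlap_le hF (Λ := 5000 * l) (by positivity) hov'
    refine ⟨F, hFk, hF, fun τ hτ => ?_, hov', x, hx, hxF, ?_⟩
    · rw [← mul_div_assoc, le_div_iff₀ hk0]
      have h1 : (τ.card : ℝ) * k ≤ 33 * (L * n) := by exact_mod_cast hsize τ hτ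
      have h2 : (L : ℝ) * n ≤ 35 * l * n := by gcongr
      have h3 : 0 ≤ (n : ℝ) * l := by positivity
      linarith
    · rw [hxs, hFk]
      have hkl : 1 ≤ k / l := by
        rw [one_le_div hl0]
        have h2 : (96 * L + 200 : ℝ) ≤ k := by exact_mod_cast hbig
        linarith
      have : (k : ℝ) / (5000 * l) = 1 / 5000 * (k / l) := by field_simp
      rw [this]
      linarith
  · obtain ⟨F, hFk, hF⟩ := hG.exists_isCDS_finset_card_eq hk
    have hkl : (k : ℝ) ≤ 4000 * l := by
      have : (k : ℝ) ≤ 96 * L + 200 := by exact_mod_cast hsmall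
      linarith
    -- One member with weight 1 suffices, as (4000 + 1)/10000 ≤ 1.
    obtain ⟨τ₀, hτ₀⟩ := Finset.card_pos.1 (hFk ▸ hk : 0 < F.card)
    obtain ⟨x, hx, hxF, hxs⟩ := exists_isCDSPacking_of_overlap_le (G := G) (F := {τ₀})
      (fun τ hτ => hF τ (Finset.mem_singleton.1 hτ ▸ hτ₀)) one_pos
      (fun v => by exact_mod_cast Finset.card_filter_le _ _)
    refine ⟨F, hFk, hF, fun τ _ => ?_, fun v => ?_, x, hx, fun τ hτ h => ?_, ?_⟩
    · rw [← mul_div_assoc, le_div_iff₀ hk0]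
      calc (τ.card : ℝ) * k ≤ n * (4000 * l) := by
            gcongr
            exact_mod_cast Finset.card_le_univ τ
        _ ≤ 5000 * (n * l) := by
            have : 0 ≤ (n : ℝ) * l := by positivity
            linarith
    · have : ((F.filter (fun τ => v ∈ τ)).card : ℝ) ≤ k := by
        exact_mod_cast hFk ▸ Finset.card_filter_le F _
      linarith
    · exact Finset.mem_singleton.1 (hxF τ hτ h) ▸ hτ₀
    · rw [hxs, Finset.card_singleton]
      have : (k : ℝ) / l ≤ 4000 := (div_le_iff₀ hl0).2 hkl
      norm_num
      linarith
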